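/- \begin{theorem} Let $H$ be a complex Hilbert space of dimension $\geq 2$ (possibly infinite), and let $\mathbf{L}(H)$ be the C$^*$-algebra of bounded linear operators on $H$ with the operator norm $\|\cdot\|$. Let $F:\mathbf{L}(H)\to\mathbf{L}(H)$ be a unital completely positive map that has an \emph{abelian factorization}: there are an abelian von Neumann algebra $\mathfrak{B}$ and unital completely positive maps $Q:\mathbf{L}(H)\to\mathfrak{B}$ and $R:\mathfrak{B}\to\mathbf{L}(H)$ such that $F=R\circ Q$. Let $U$ be a unitary operator on $H$. (i) For every real $\beta<\sqrt{2}/4$ there is a non-zero $T\in\mathbf{L}(H)$ such that $$\|U^\dagger T U-F(T)\|\;\geq\;\beta\,\|T\| .$$ (ii) If $H$ is finite-dimensional, then (i) also holds with $\beta=\sqrt{2}/4$: there is a non-zero $T\in\mathbf{L}(H)$ such that $$\|U^\dagger T U-F(T)\|\;\geq\;\frac{\sqrt{2}}{4}\,\|T\| .$$ \end{theorem} -/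

import Mathlib

open scoped CStarAlgebra

universe u v

namespace VonNeumannAlgebra

variable {K : Type v} [NormedAddCommGroup K] [InnerProductSpace ℂ K] [CompleteSpace K]

instance instSMulMemClass : SMulMemClass (VonNeumannAlgebra K) ℂ (K →L[ℂ] K) where
  smul_mem {S} c _ hx := S.toStarSubalgebra.smul_mem hx c

theorem isClosed_coe (S : VonNeumannAlgebra K) : IsClosed (S : Set (K →L[ℂ] K)) := by
  rw [← S.centralizer_centralizer]
  exact Set.isClosed_centralizer _

/-- A von Neumann algebra, with the operations and the operator norm inherited from the bounded
operators, is a unital C⋆-algebra. -/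
noncomputable instance instCStarAlgebra (S : VonNeumannAlgebra K) : CStarAlgebra S :=
  StarSubalgebra.cstarAlgebra S (h_closed := S.isClosed_coe)

/-- The order that a von Neumann algebra inherits from the (Loewner) order on bounded operators is
its order as a C⋆-algebra. -/
instance instStarOrderedRing (S : VonNeumannAlgebra K) : StarOrderedRing S := by
  refine StarOrderedRing.of_nonneg_iff' (fun {x y} h z => ?_) (fun x => ?_)
  · exact add_le_add_right (α := K →L[ℂ] K) (b := (x : K →L[ℂ] K)) (c := y) h (z : K →L[ℂ] K)
  · constructor
    · intro hx
      have hx' : (0 : K →L[ℂ] K) ≤ x := hx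
      have hmem : CFC.sqrt (x : K →L[ℂ] K) ∈ S := by
        rw [← SetLike.mem_coe, ← S.centralizer_centralizer]
        intro y hy
        have hxy : Commute (x : K →L[ℂ] K) y := hy x x.2
        exact (hxy.cfcₙ_nnreal NNReal.sqrt).symm
      refine ⟨⟨_, hmem⟩, Subtype.ext ?_⟩
      change (x : K →L[ℂ] K) = star (CFC.sqrt (x : K →L[ℂ] K)) * CFC.sqrt (x : K →L[ℂ] K)
      rw [(CFC.sqrt_nonneg (x : K →L[ℂ] K)).isSelfAdjoint.star_eq,
        CFC.sqrt_mul_sqrt_self (x : K →L[ℂ] K) hx']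
    · rintro ⟨s, rfl⟩
      exact star_mul_self_nonneg (s : K →L[ℂ] K)

end VonNeumannAlgebra

/-- A unital completely positive map `F : A → A` on a unital C⋆-algebra has an abelian
factorization if `F = R ∘ Q` for unital completely positive maps `Q : A → 𝔅`, `R : 𝔅 → A` and an
abelian von Neumann algebra `𝔅`, acting on some Hilbert space `K`. -/
def HasAbelianFactorization {A : Type u} [CStarAlgebra A] [PartialOrder A] [StarOrderedRing A]
    (F : A →CP A) : Prop :=
  ∃ (K : Type v) (_ : NormedAddCommGroup K) (_ : InnerProductSpace ℂ K) (_ : CompleteSpace K)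
    (𝔅 : VonNeumannAlgebra K) (Q : A →CP 𝔅) (R : 𝔅 →CP A),
    (∀ S ∈ 𝔅, ∀ T ∈ 𝔅, S * T = T * S) ∧ Q 1 = 1 ∧ R 1 = 1 ∧ ∀ T : A, F T = R (Q T)

section KadisonSchwarz

variable {A : Type*} {B : Type*} [CStarAlgebra A] [PartialOrder A] [StarOrderedRing A]
  [CStarAlgebra B] [PartialOrder B] [StarOrderedRing B]

/-! Factoring through an abelian algebra turns Kadison–Schwarz into `F(a)* F(a) ≤ F(a a*)`, which
conjugation by `U` violates. For orthonormal `x`, `y` let `S = |Ux⟩⟨Uy|` and `P = S S* = |Ux⟩⟨Ux|`: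
conjugation turns `S` into a map `y ↦ x` and `P` into one killing `y`, whereas `‖F(S) y‖² ≤ ‖F(P)
y‖`. Hence `F` is far from the conjugation at `S` or at `P`. -/

theorem CStarMatrix.mul_star_row_nonneg (a : A) :
    0 ≤ (CStarMatrix.ofMatrix !![1, a; star a, star a * a] : CStarMatrix (Fin 2) (Fin 2) A) := by
  have h : (CStarMatrix.ofMatrix !![1, a; star a, star a * a] : CStarMatrix (Fin 2) (Fin 2) A) =
      star (CStarMatrix.ofMatrix !![1, a; 0, 0]) * CStarMatrix.ofMatrix !![1, a; 0, 0] := by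
    ext i j
    fin_cases i <;> fin_cases j <;>
      simp [CStarMatrix.mul_apply, CStarMatrix.star_apply, Fin.sum_univ_two]
  rw [h]
  exact star_mul_self_nonneg _

theorem CStarMatrix.diag_nonneg {n : Type*} [Fintype n] {M : CStarMatrix n n A} (hM : 0 ≤ M)
    (i : n) : 0 ≤ M i i := by
  rw [StarOrderedRing.nonneg_iff] at hM
  induction hM using AddSubmonoid.closure_induction with
  | mem M hM =>
    obtain ⟨N, rfl⟩ := hM
    simp only [CStarMatrix.mul_apply, CStarMatrix.star_apply]
    exact Finset.sum_nonneg fun k _ => star_mul_self_nonneg (N k i)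
  | zero => exact le_rfl
  | add M N _ _ hM hN => exact add_nonneg hM hN

/-- Schur complement: compressing the matrix by the column `(-x, 1)` leaves `y - x* x`. -/
theorem CStarMatrix.star_mul_le_of_nonneg {x y : A}
    (h : 0 ≤ (CStarMatrix.ofMatrix !![1, x; star x, y] : CStarMatrix (Fin 2) (Fin 2) A)) :
    star x * x ≤ y := by
  have h00 := CStarMatrix.diag_nonneg (star_left_conjugate_nonneg h
    (CStarMatrix.ofMatrix !![-x, 0; 1, 0] : CStarMatrix (Fin 2) (Fin 2) A)) 0
  simpa [CStarMatrix.mul_apply, CStarMatrix.star_apply, Fin.sum_univ_two] using h00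

/-- The Kadison–Schwarz inequality for unital completely positive maps. -/
theorem CompletelyPositiveMap.star_map_mul_map_le (φ : A →CP B) (hφ : φ 1 = 1) (a : A) :
    star (φ a) * φ a ≤ φ (star a * a) := by
  have hpos := φ.map_cstarMatrix_nonneg _ (CStarMatrix.mul_star_row_nonneg a)
  have hstar : φ (star a) = star (φ a) := map_star φ a
  apply CStarMatrix.star_mul_le_of_nonneg
  convert hpos using 1
  ext i j
  fin_cases i <;> fin_cases j <;> simp [hφ, hstar]

end KadisonSchwarz

/-- A unital completely positive map that factors through an abelian algebra satisfies the
Kadison–Schwarz inequality with the two factors on the right-hand side exchanged. -/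
theorem HasAbelianFactorization.star_map_mul_map_le {A : Type u} [CStarAlgebra A] [PartialOrder A]
    [StarOrderedRing A] {F : A →CP A} (hF : HasAbelianFactorization.{u, v} F) (a : A) :
    star (F a) * F a ≤ F (a * star a) := by
  obtain ⟨K, _, _, _, 𝔅, Q, R, hcomm, hQ, hR, hfac⟩ := hF
  have hQa : star (Q a) = Q (star a) := (map_star Q a).symm
  have hswap : star (Q a) * Q a ≤ Q (a * star a) := by
    -- At `star a` the inequality bounds `Q a * star (Q a)`; commutativity then swaps the factors.
    have h := Q.star_map_mul_map_le hQ (star a)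
    rw [← hQa, star_star, star_star] at h
    rwa [show star (Q a) * Q a = Q a * star (Q a) from
      Subtype.ext (hcomm _ (star (Q a)).2 _ (Q a).2)]
  rw [hfac, hfac]
  exact (R.star_map_mul_map_le hR (Q a)).trans (OrderHomClass.mono R hswap)

section Hilbert

variable {H : Type*} [NormedAddCommGroup H] [InnerProductSpace ℂ H]

theorem exists_orthonormal_pair_of_two_le_rank (hdim : 2 ≤ Module.rank ℂ H) :
    ∃ x y : H, ‖x‖ = 1 ∧ ‖y‖ = 1 ∧ inner ℂ x y = 0 := by
  have hlt : 1 < Module.rank ℂ H := lt_of_lt_of_le (by norm_num) hdim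
  have : Nontrivial H := rank_pos_iff_nontrivial.mp (zero_lt_one.trans hlt)
  obtain ⟨x, hx⟩ := exists_ne (0 : H)
  obtain ⟨y, hy⟩ := exists_linearIndependent_pair_of_one_lt_rank hlt hx
  have ho := InnerProductSpace.gramSchmidtNormed_orthonormal hy
  exact ⟨_, _, ho.1 0, ho.1 1, ho.2 (by decide)⟩

variable [CompleteSpace H]

theorem ContinuousLinearMap.norm_sq_apply_le_of_star_mul_self_le {S T : H →L[ℂ] H}
    (h : star S * S ≤ T) (x : H) : ‖S x‖ ^ 2 ≤ ‖x‖ * ‖T x‖ := by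
  have hpos := ((ContinuousLinearMap.le_def _ _).mp h).re_inner_nonneg_right x
  have hS : RCLike.re (inner ℂ x ((star S * S) x)) = ‖S x‖ ^ 2 := by
    rw [ContinuousLinearMap.star_eq_adjoint, mul_apply_eq_comp,
      ContinuousLinearMap.adjoint_inner_right, inner_self_eq_norm_sq]
  rw [sub_apply, inner_sub_right, map_sub, hS] at hpos
  have := re_inner_le_norm (𝕜 := ℂ) x (T x)
  linarith

end Hilbert

theorem exists_le_norm_conj_sub_of_hasAbelianFactorization {H : Type u} [NormedAddCommGroup H]
    [InnerProductSpace ℂ H] [CompleteSpace H] (hdim : 2 ≤ Module.rank ℂ H)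
    {F : (H →L[ℂ] H) →CP (H →L[ℂ] H)} (hF : HasAbelianFactorization.{u, v} F)
    {U : H →L[ℂ] H} (hU : U ∈ unitary (H →L[ℂ] H)) :
    ∃ T : H →L[ℂ] H, T ≠ 0 ∧ √2 / 4 * ‖T‖ ≤ ‖U.adjoint * T * U - F T‖ := by
  obtain ⟨x, y, hx, hy, hxy⟩ := exists_orthonormal_pair_of_two_le_rank hdim
  have hUU : U.adjoint * U = 1 := (Unitary.mem_iff.mp hU).1
  have hadj (z : H) : U.adjoint (U z) = z := by
    rw [← mul_apply_eq_comp, hUU, one_apply_eq_self]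
  have hinner (z w : H) : inner ℂ (U z) (U w) = inner ℂ z w := by
    rw [← ContinuousLinearMap.adjoint_inner_right, hadj]
  have hnorm (z : H) : ‖U z‖ = ‖z‖ := by
    rw [@norm_eq_sqrt_re_inner ℂ, hinner, ← @norm_eq_sqrt_re_inner ℂ]
  set S : H →L[ℂ] H := InnerProductSpace.rankOne ℂ (U x) (U y) with hS
  set P : H →L[ℂ] H := InnerProductSpace.rankOne ℂ (U x) (U x) with hP
  have hSn : ‖S‖ = 1 := by simp [hS, hnorm, hx, hy]
  have hPn : ‖P‖ = 1 := by simp [hP, hnorm, hx]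
  have hSP : S * star S = P := by
    ext z
    simp [hS, hP, ContinuousLinearMap.star_eq_adjoint, hnorm, hy]
  have hSy : (U.adjoint * S * U) y = x := by simp [hS, hnorm, hy, hadj]
  have hPy : (U.adjoint * P * U) y = 0 := by simp [hP, hinner, hxy]
  by_contra! hcon
  have hS1 := hcon S (norm_ne_zero_iff.mp (by simp [hSn]))
  have hP1 := hcon P (norm_ne_zero_iff.mp (by simp [hPn]))
  rw [hSn, mul_one] at hS1
  rw [hPn, mul_one] at hP1
  have hSle := (U.adjoint * S * U - F S).le_opNorm y
  have hPle := (U.adjoint * P * U - F P).le_opNorm y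
  rw [sub_apply, hSy, hy, mul_one] at hSle
  rw [sub_apply, hPy, hy, mul_one, zero_sub, norm_neg] at hPle
  have hKS := ContinuousLinearMap.norm_sq_apply_le_of_star_mul_self_le
    (hF.star_map_mul_map_le S) y
  rw [hSP, hy, one_mul] at hKS
  have htri := norm_sub_norm_le x (F S y)
  rw [hx] at htri
  -- With both errors below `c`, `(1 - c)² < ‖F S y‖² ≤ ‖F P y‖ < c`. This is impossible for `c ≤ (3
  -- - √5)/2 ≈ 0.382`, so `0.36` leaves room.
  have hsqrt : √2 / 4 < 0.36 := by
    have : √2 < 1.44 := by rw [Real.sqrt_lt' (by norm_num)]; norm_num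
    linarith
  nlinarith

theorem mainTheorem2 {H : Type u} [NormedAddCommGroup H] [InnerProductSpace ℂ H] [CompleteSpace H]
    (hdim : 2 ≤ Module.rank ℂ H)
    (F : (H →L[ℂ] H) →CP (H →L[ℂ] H)) (hF_unital : F 1 = 1)
    (hF : HasAbelianFactorization.{u, v} F)
    (U : H →L[ℂ] H) (hU : U ∈ unitary (H →L[ℂ] H)) :
    (∀ β : ℝ, β < √2 / 4 →
      ∃ T : H →L[ℂ] H, T ≠ 0 ∧ β * ‖T‖ ≤ ‖U.adjoint * T * U - F T‖) ∧
    (FiniteDimensional ℂ H →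
      ∃ T : H →L[ℂ] H, T ≠ 0 ∧ √2 / 4 * ‖T‖ ≤ ‖U.adjoint * T * U - F T‖) := by
  have h := exists_le_norm_conj_sub_of_hasAbelianFactorization hdim hF hU
  refine ⟨fun β hβ => ?_, fun _ => h⟩
  obtain ⟨T, hT, hle⟩ := h
  exact ⟨T, hT, (mul_le_mul_of_nonneg_right hβ.le (norm_nonneg T)).trans hle⟩
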